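/- Let $G=(V,E)$ be a finite simple undirected graph with at least three vertices and let $a : V \to \mathbb{Z}$ be a weight function with $a(v)>0$ for all $v\in V$. For $S\subseteq V$ put $a(S)=\sum_{v\in S}a(v)$ and let $\|S\|$ be the number of edges of $G$ with both ends in $S$. Let $$\beta(G,a)=\max_{S\subseteq V}\bigl(a(S)-\|S\|\bigr),\qquad \lambda = a(V)-2\beta(G,a);$$ $\lambda$ is called the subdefect of $(G,a)$. Let $N$ be a finite set that contains $V$ and a set $V'$ disjoint from $V$, and let $v\mapsto v'$ be a bijection from $V$ onto $V'$. Let $P^N_{\mathrm{LO}}\subset\mathbb{R}^{A}$, with $A=\{(i,j)\in N\times N : i\neq j\}$, be the linear ordering polytope, that is, the convex hull of the incidence vectors of all strict linear orderings of $N$. The weighted graph $(G,a)$ is called facet-defining if the graphical inequality $$\sum_{v\in V}a(v)\,x_{vv'}-\sum_{vw\in E}\bigl(x_{vw'}+x_{wv'}\bigr)\le\beta(G,a)$$ defines a facet of $P^N_{\mathrm{LO}}$. If $(G,a)$ is facet-defining, then $$\deg(v)\le a(v)+\lambda\le 2\lambda\quad\text{for every } v\in V,$$ and if moreover $\lambda>1$,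 then also $\deg(v)\le 2\lambda-1$ for every $v\in V$. -/

import Mathlib

open Finset

/-- The arcs of the complete directed graph on the node set `N`. -/
abbrev Arc (N : Type*) : Type _ := {p : N × N // p.1 ≠ p.2}

/-- The incidence vector in `ℝ^A` (`A` the set of arcs) of a relation on `N`. -/
noncomputable def arcIncidence {N : Type*} (r : N → N → Prop) : Arc N → ℝ :=
  open Classical in fun e => if r e.1.1 e.1.2 then 1 else 0

/-- The linear ordering polytope on `N`: the convex hull of the incidence vectors of
all strict linear orderings of `N`. -/
def linearOrderingPolytope (N : Type*) : Set (Arc N → ℝ) :=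
  convexHull ℝ {x | ∃ r : N → N → Prop, IsStrictTotalOrder N r ∧ x = arcIncidence r}

/-- The inequality `f x ≤ b` defines a facet of `P`: it is valid for `P`, and the face
`{x ∈ P | f x = b}` is non-empty and its dimension is one less than the dimension of `P`. -/
def DefinesFacet {E : Type*} [AddCommGroup E] [Module ℝ E] (P : Set E) (f : E → ℝ) (b : ℝ) :
    Prop :=
  (∀ x ∈ P, f x ≤ b) ∧
  {x | x ∈ P ∧ f x = b}.Nonempty ∧
  Module.finrank ℝ (vectorSpan ℝ {x | x ∈ P ∧ f x = b}) + 1 =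
    Module.finrank ℝ (vectorSpan ℝ P)

section WeightedGraph

variable {V : Type*} [Fintype V] [DecidableEq V] (G : SimpleGraph V) [DecidableRel G.Adj]
  (a : V → ℕ)

/-- `||S||`: the number of edges of `G` with both ends in `S`. -/
def numEdgesIn (S : Finset V) : ℕ := #{e ∈ G.edgeFinset | ∀ v ∈ e, v ∈ S}

/-- The worth `a(S) - ||S||` of a set `S` of vertices. -/
def worth (S : Finset V) : ℤ := ((∑ v ∈ S, a v : ℕ) : ℤ) - (numEdgesIn G S : ℤ)

/-- `β(G,a)`: the maximum worth of a set of vertices. -/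
def maxWorth : ℤ := (univ : Finset (Finset V)).sup' univ_nonempty (worth G a)

/-- The subdefect `a(V(G)) - 2 β(G,a)`. -/
def subdefect : ℤ := ((∑ v, a v : ℕ) : ℤ) - 2 * maxWorth G a

variable {N : Type*} (ι κ : V → N) (hικ : ∀ v w, ι v ≠ κ w)

/-- The left-hand side `∑_{v ∈ V} a(v) x_{vv'} - ∑_{vw ∈ E} (x_{vw'} + x_{wv'})` of the
graphical inequality, where the node of `N` that represents `v` is `ι v` and `v'` is `κ v`. -/
def graphicalForm (x : Arc N → ℝ) : ℝ :=
  (∑ v, (a v : ℝ) * x ⟨(ι v, κ v), hικ v v⟩) -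
    ∑ e ∈ G.edgeFinset,
      Sym2.lift ⟨fun v w => x ⟨(ι v, κ w), hικ v w⟩ + x ⟨(ι w, κ v), hικ w v⟩,
        fun _ _ => add_comm _ _⟩ e

end WeightedGraph

/-- `(G,a)` is a facet-defining graph: it has at least three vertices and positive weights, and
its graphical inequality defines a facet of the linear ordering polytope on a finite node set
`N`. Here `ι` identifies `V` with a subset of `N`, and `κ`, which is `v ↦ v'`, is a bijection
from `V` onto a subset `V'` of `N` that is disjoint from `V`. -/
structure IsFacetDefiningGraph {V : Type*} [Fintype V] [DecidableEq V] (G : SimpleGraph V)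
    [DecidableRel G.Adj] (a : V → ℕ) {N : Type*} (ι κ : V ↪ N) (hικ : ∀ v w, ι v ≠ κ w) :
    Prop where
  three_le_card : 3 ≤ Fintype.card V
  weight_pos : ∀ v, 0 < a v
  definesFacet : DefinesFacet (linearOrderingPolytope N) (graphicalForm G a ι κ hικ)
    (maxWorth G a : ℝ)

/-! Call `S` tight if its worth is `β`. For a linear ordering on the facet, the set of `v` preceding
`v'` is tight. Hence an affine equation in vertex and edge indicators that holds for all tight sets
is a multiple of `a(S) - ‖S‖ = β` (`IsFacetDefiningGraph.exists_eq_mul`). It follows that each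
vertex, and each edge with both its ends, lies in some tight set and is disjoint from another.

For `I ⊆ U` and `T` tight, passing to `(I ∩ T, U ∪ T)` does not lower `pairWorth`. Uncrossing with
all tight sets bounds it by `a(V)`; uncrossing only with those avoiding `v`, or only with those
containing `v`, leaves room for a further `a(v)`, or `deg(v) - a(v)`. For `I = U` tight the value is
`2β`, whence `a(v) ≤ λ` and `deg(v) ≤ a(v) + λ`.

If `deg(v) ≥ 2λ ≥ 4`, both bounds are equalities. Then no edge lies in `S \ T` for tight `S`, `T`
that agree on `v`, as it would push `pairWorth (S ∩ T) (S ∪ T)` above `2β`. So on each of the two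
classes edge indicators are affine in vertex indicators, and since `|E| > |V|`, linear algebra
yields a forbidden equation (`card_edgeFinset_le`). -/

/-! ### Worth of pairs of vertex sets and uncrossing -/

section Combinatorics

variable {V : Type*} (G : SimpleGraph V) [DecidableRel G.Adj] (a : V → ℕ)

/-- The number of pairs in `I × U` that are adjacent. -/
def adjPairs (I U : Finset V) : ℤ := ∑ i ∈ I, ∑ u ∈ U, if G.Adj i u then 1 else 0

/-- The weight of `I` plus the weight of `U` minus the number of adjacent pairs in `I × U`;
for `I = U` this is twice the worth. -/
def pairWorth (I U : Finset V) : ℤ :=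
  ∑ v ∈ I, (a v : ℤ) + ∑ v ∈ U, (a v : ℤ) - adjPairs G I U

lemma adjPairs_comm (I U : Finset V) : adjPairs G I U = adjPairs G U I := by
  unfold adjPairs
  rw [sum_comm]
  simp only [G.adj_comm]

lemma adjPairs_nonneg (I U : Finset V) : 0 ≤ adjPairs G I U :=
  sum_nonneg fun _ _ => sum_nonneg fun _ _ => by split_ifs <;> simp

variable {G} in
lemma adjPairs_mono {I I' U U' : Finset V} (hI : I ⊆ I') (hU : U ⊆ U') :
    adjPairs G I U ≤ adjPairs G I' U' := by
  unfold adjPairs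
  calc _ ≤ ∑ i ∈ I, ∑ u ∈ U', (if G.Adj i u then (1 : ℤ) else 0) :=
        sum_le_sum fun _ _ => sum_le_sum_of_subset_of_nonneg hU
          fun _ _ _ => by split_ifs <;> simp
    _ ≤ _ := sum_le_sum_of_subset_of_nonneg hI
          fun _ _ _ => sum_nonneg fun _ _ => by split_ifs <;> simp

lemma adjPairs_singleton_univ [Fintype V] (v : V) :
    adjPairs G {v} univ = G.degree v := by
  simp [adjPairs, ← G.card_neighborFinset_eq_degree, G.neighborFinset_eq_filter]

variable {G} in
lemma adjPairs_pos {I U : Finset V} {v w : V} (hv : v ∈ I) (hw : w ∈ U) (h : G.Adj v w) :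
    0 < adjPairs G I U := by
  have := adjPairs_mono (G := G) (singleton_subset_iff.2 hv) (singleton_subset_iff.2 hw)
  simp only [adjPairs, sum_singleton, h, if_true] at this ⊢
  linarith

variable [DecidableEq V]

lemma inter_union_sdiff_self (S T : Finset V) : S ∩ T ∪ S \ T = S := by
  rw [union_comm, sdiff_union_inter]

lemma adjPairs_union_left {I J : Finset V} (h : Disjoint I J) (U : Finset V) :
    adjPairs G (I ∪ J) U = adjPairs G I U + adjPairs G J U :=
  sum_union h

lemma adjPairs_union_right {I J : Finset V} (h : Disjoint I J) (U : Finset V) :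
    adjPairs G U (I ∪ J) = adjPairs G U I + adjPairs G U J := by
  simp only [adjPairs_comm G U, adjPairs_union_left G h]

lemma adjPairs_inter_add_diff_left (I T U : Finset V) :
    adjPairs G (I ∩ T) U + adjPairs G (I \ T) U = adjPairs G I U := by
  rw [← adjPairs_union_left G (disjoint_sdiff_inter I T).symm, inter_union_sdiff_self]

/-- The weights are modular. Among the blocks `S ∩ T`, `S \ T`, `T \ S`, the left side misses
exactly the adjacent pairs inside the two differences. -/
lemma pairWorth_inter_union (S T : Finset V) :
    2 * pairWorth G a (S ∩ T) (S ∪ T) =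
      pairWorth G a S S + pairWorth G a T T + adjPairs G (S \ T) (S \ T)
        + adjPairs G (T \ S) (T \ S) := by
  have hS : S = (S ∩ T) ∪ (S \ T) := (inter_union_sdiff_self S T).symm
  have hT : T = (S ∩ T) ∪ (T \ S) := by rw [inter_comm, inter_union_sdiff_self]
  have hU : S ∪ T = ((S ∩ T) ∪ (S \ T)) ∪ (T \ S) := by
    rw [inter_union_sdiff_self, union_sdiff_self_eq_union]
  have d1 : Disjoint (S ∩ T) (S \ T) := (disjoint_sdiff_inter S T).symm
  have d2 : Disjoint (S ∩ T) (T \ S) := by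
    rw [inter_comm]; exact (disjoint_sdiff_inter T S).symm
  have d3 : Disjoint ((S ∩ T) ∪ (S \ T)) (T \ S) := by
    rw [inter_union_sdiff_self]; exact disjoint_sdiff
  have eS : pairWorth G a S S =
      pairWorth G a ((S ∩ T) ∪ (S \ T)) ((S ∩ T) ∪ (S \ T)) := by rw [← hS]
  have eT : pairWorth G a T T =
      pairWorth G a ((S ∩ T) ∪ (T \ S)) ((S ∩ T) ∪ (T \ S)) := by rw [← hT]
  rw [eS, eT, hU]
  generalize S ∩ T = A at *
  generalize S \ T = B at *
  generalize T \ S = C at *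
  simp only [pairWorth, sum_union d1, sum_union d2, sum_union d3, adjPairs_union_left G d1,
    adjPairs_union_left G d2, adjPairs_union_right G d1, adjPairs_union_right G d2,
    adjPairs_union_right G d3, adjPairs_comm G B A, adjPairs_comm G C A]
  ring

variable {G a} in
/-- Intersecting the smaller and enlarging the bigger member of a nested pair by a set of maximum
worth does not decrease the worth of the pair. -/
lemma pairWorth_le_inter_union {T : Finset V}
    (hT : ∀ S, pairWorth G a S S ≤ pairWorth G a T T) {I U : Finset V} (hIU : I ⊆ U) :
    pairWorth G a I U ≤ pairWorth G a (I ∩ T) (U ∪ T) := by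
  -- The competitor of `T` drops `T \ U` and gains `I \ T`, the two sets by which the pairs `(I, U)`
  -- and `(I ∩ T, U ∪ T)` differ.
  have hQ := hT ((T ∩ U) ∪ (I \ T))
  have d1 : Disjoint (T ∩ U) (I \ T) :=
    disjoint_of_subset_left inter_subset_left disjoint_sdiff
  have d2 : Disjoint (T ∩ U) (T \ U) := (disjoint_sdiff_inter T U).symm
  have d3 : Disjoint U (T \ U) := disjoint_sdiff
  have eT : pairWorth G a T T =
      pairWorth G a ((T ∩ U) ∪ (T \ U)) ((T ∩ U) ∪ (T \ U)) := by rw [inter_union_sdiff_self]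
  have e1 := sum_inter_add_sum_sdiff I T (fun v => (a v : ℤ))
  have e2 := adjPairs_inter_add_diff_left G I T U
  have m1 : adjPairs G (I \ T) ((T ∩ U) ∪ (I \ T)) ≤ adjPairs G (I \ T) U :=
    adjPairs_mono Subset.rfl
      (union_subset inter_subset_right (sdiff_subset.trans hIU))
  have m2 : adjPairs G (I ∩ T) (T \ U) ≤ adjPairs G (T ∩ U) (T \ U) :=
    adjPairs_mono (fun x hx => mem_inter.2
      ⟨(mem_inter.1 hx).2, hIU (mem_inter.1 hx).1⟩) Subset.rfl
  have m3 := adjPairs_nonneg G (I \ T) (I \ T)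
  have m4 := adjPairs_nonneg G (T \ U) (T \ U)
  rw [eT] at hQ
  rw [← union_sdiff_self_eq_union (s := U) (t := T)]
  simp only [pairWorth, sum_union d1, sum_union d2, sum_union d3, adjPairs_union_left G d1,
    adjPairs_union_left G d2, adjPairs_union_right G d1, adjPairs_union_right G d2,
    adjPairs_union_right G d3, adjPairs_comm G (I \ T) (T ∩ U),
    adjPairs_comm G (T \ U) (T ∩ U)] at hQ m1 ⊢
  linarith

variable {G a} in
lemma pairWorth_le_filter_biUnion {F : Finset (Finset V)}
    (hF : ∀ T ∈ F, ∀ S, pairWorth G a S S ≤ pairWorth G a T T) {I I' U : Finset V} (hIU : I ⊆ U)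
    (hI' : ∀ x, x ∈ I' ↔ x ∈ I ∧ ∀ T ∈ F, x ∈ T) :
    pairWorth G a I U ≤ pairWorth G a I' (U ∪ F.biUnion id) := by
  obtain rfl : I' = {x ∈ I | ∀ T ∈ F, x ∈ T} := by ext x; rw [hI', mem_filter]
  clear hI'
  induction F using Finset.induction_on with
  | empty => simp
  | insert T F _ ih =>
    have h1 := ih fun T hT => hF T (mem_insert_of_mem hT)
    have h2 := pairWorth_le_inter_union (hF T (mem_insert_self T F))
      ((filter_subset (fun x => ∀ T ∈ F, x ∈ T) I).trans
        (hIU.trans (subset_union_left (s₂ := F.biUnion id))))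
    have e1 : {x ∈ I | ∀ T' ∈ insert T F, x ∈ T'} = {x ∈ I | ∀ T ∈ F, x ∈ T} ∩ T := by
      ext x; simp only [mem_filter, mem_inter, forall_mem_insert]; tauto
    have e2 : U ∪ (insert T F).biUnion id = U ∪ F.biUnion id ∪ T := by
      ext x; simp only [mem_union, mem_biUnion, exists_mem_insert, id, or_assoc, or_comm (a := x ∈ T)]
    rw [e1, e2]
    exact h1.trans h2

variable [Fintype V]

lemma two_mul_numEdgesIn (S : Finset V) : 2 * (numEdgesIn G S : ℤ) = adjPairs G S S := by
  have key : ∀ i ∈ S, ({e ∈ G.edgeFinset | (∀ v ∈ e, v ∈ S) ∧ i ∈ e} : Finset (Sym2 V)) =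
      ({u ∈ S | G.Adj i u} : Finset V).image (fun u => s(i, u)) := by
    intro i hi
    ext e
    simp only [mem_filter, mem_image, SimpleGraph.mem_edgeFinset]
    constructor
    · rintro ⟨he, hS, hie⟩
      obtain ⟨u, rfl⟩ := hie
      exact ⟨u, ⟨hS u (Sym2.mem_mk_right i u), he⟩, rfl⟩
    · rintro ⟨u, ⟨hu, hiu⟩, rfl⟩
      refine ⟨hiu, fun v hv => ?_, Sym2.mem_mk_left i u⟩
      rcases Sym2.mem_iff.1 hv with rfl | rfl <;> assumption
  have h2 : ∀ e ∈ ({e ∈ G.edgeFinset | ∀ v ∈ e, v ∈ S} : Finset (Sym2 V)),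
      #{i ∈ S | i ∈ e} = 2 := by
    intro e he
    induction e with | _ x y
    simp only [mem_filter, SimpleGraph.mem_edgeFinset] at he
    have hxy : x ≠ y := G.ne_of_adj he.1
    have : ({i ∈ S | i ∈ s(x, y)} : Finset V) = {x, y} := by
      ext i
      simp only [mem_filter, Sym2.mem_iff, mem_insert, mem_singleton]
      refine ⟨fun h => h.2, fun h => ⟨he.2 i (Sym2.mem_iff.2 h), h⟩⟩
    rw [this, card_pair hxy]
  have h3 := sum_card_bipartiteAbove_eq_sum_card_bipartiteBelow (fun (i : V) (e : Sym2 V) => i ∈ e)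
    (s := S) (t := ({e ∈ G.edgeFinset | ∀ v ∈ e, v ∈ S} : Finset (Sym2 V)))
  simp only [bipartiteAbove, bipartiteBelow, filter_filter] at h3
  rw [sum_congr rfl h2, sum_const, smul_eq_mul, sum_congr rfl fun i hi => by
    rw [key i hi, card_image_of_injective _ (fun _ _ => Sym2.congr_right.1)]] at h3
  unfold numEdgesIn adjPairs
  simp only [sum_boole]
  rw [mul_comm]
  exact_mod_cast h3.symm

lemma pairWorth_self (S : Finset V) : pairWorth G a S S = 2 * worth G a S := by
  unfold pairWorth worth
  rw [← two_mul_numEdgesIn]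
  push_cast
  ring

lemma worth_le_maxWorth (S : Finset V) : worth G a S ≤ maxWorth G a :=
  le_sup' _ (mem_univ S)

end Combinatorics

/-! ### Linear forms constant on a facet -/

section Face

variable {E : Type*} [AddCommGroup E] [Module ℝ E] [FiniteDimensional ℝ E]

/-- A linear form that is constant on a facet is, up to a constant, a multiple of the linear form
that defines the facet. -/
lemma DefinesFacet.exists_eq_mul {P : Set E} {f g : E →ₗ[ℝ] ℝ} {b c : ℝ}
    (h : DefinesFacet P f b) (hg : ∀ x ∈ P, f x = b → g x = c) {p q : E} (hp : p ∈ P) (hq : q ∈ P)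
    (hpq : f p ≠ f q) : ∃ μ : ℝ, ∀ x ∈ P, ∀ y ∈ P, g x - g y = μ * (f x - f y) := by
  obtain ⟨-, -, hdim⟩ := h
  set F : Set E := {x | x ∈ P ∧ f x = b}
  have hFP : vectorSpan ℝ F ≤ vectorSpan ℝ P := vectorSpan_mono ℝ fun x hx => hx.1
  have hFf : vectorSpan ℝ F ≤ LinearMap.ker f := by
    refine Submodule.span_le.2 ?_
    rintro _ ⟨x, hx, y, hy, rfl⟩
    simp [hx.2, hy.2]
  have hFg : vectorSpan ℝ F ≤ LinearMap.ker g := by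
    refine Submodule.span_le.2 ?_
    rintro _ ⟨x, hx, y, hy, rfl⟩
    simp [hg x hx.1 hx.2, hg y hy.1 hy.2]
  have hpqP : p - q ∈ vectorSpan ℝ P := vsub_mem_vectorSpan ℝ hp hq
  have hfpq : f (p - q) ≠ 0 := by simpa [sub_eq_zero] using hpq
  have hlt : vectorSpan ℝ P ⊓ LinearMap.ker f < vectorSpan ℝ P :=
    lt_of_le_of_ne inf_le_left fun h => hfpq (by
      have := h ▸ hpqP
      exact (Submodule.mem_inf.1 this).2)
  -- The right side has codimension at least one in the span of `P`, and the left side, contained in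
  -- it, exactly one.
  have hFeq : vectorSpan ℝ F = vectorSpan ℝ P ⊓ LinearMap.ker f := by
    refine Submodule.eq_of_le_of_finrank_le (le_inf hFP hFf) ?_
    have := Submodule.finrank_lt_finrank_of_lt hlt
    omega
  refine ⟨g (p - q) / f (p - q), fun x hx y hy => ?_⟩
  have hxy : x - y ∈ vectorSpan ℝ P := vsub_mem_vectorSpan ℝ hx hy
  have hmem : (x - y) - (f (x - y) / f (p - q)) • (p - q) ∈ vectorSpan ℝ F := by
    rw [hFeq, Submodule.mem_inf]
    refine ⟨Submodule.sub_mem _ hxy (Submodule.smul_mem _ _ hpqP), ?_⟩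
    rw [LinearMap.mem_ker, map_sub, map_smul, smul_eq_mul, div_mul_cancel₀ _ hfpq, sub_self]
  have := hFg hmem
  rw [LinearMap.mem_ker, map_sub, map_smul, smul_eq_mul, sub_eq_zero] at this
  rw [← map_sub, ← map_sub, this]
  field_simp

end Face

/-! ### Linear orderings and the vertex sets they select -/

section ArcForm

variable {V : Type*} {N : Type*} (ι κ : V → N) (hικ : ∀ v w, ι v ≠ κ w)

/-- The linear form `x ↦ x_{vw'} + x_{wv'}` of an unordered pair of vertices `v`, `w`. -/
def crossForm : Sym2 V → (Arc N → ℝ) →ₗ[ℝ] ℝ :=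
  Sym2.lift ⟨fun v w => LinearMap.proj ⟨(ι v, κ w), hικ v w⟩ + LinearMap.proj ⟨(ι w, κ v), hικ w v⟩,
    fun _ _ => add_comm _ _⟩

lemma crossForm_mk (v w : V) (x : Arc N → ℝ) :
    crossForm ι κ hικ s(v, w) x = x ⟨(ι v, κ w), hικ v w⟩ + x ⟨(ι w, κ v), hικ w v⟩ := rfl

/-- The strict linear orderings with prescribed levels. -/
lemma exists_isStrictTotalOrder_of_level [Finite N] (k : N → ℕ) :
    ∃ r : N → N → Prop, IsStrictTotalOrder N r ∧ ∀ x y, k x ≠ k y → (r x y ↔ k x < k y) := by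
  obtain ⟨n, ⟨e⟩⟩ := Finite.exists_equiv_fin N
  let φ : N → ℕ ×ₗ Fin n := fun x => toLex (k x, e x)
  have hφ : Function.Injective φ := fun x y h => e.injective (congrArg (fun p => (ofLex p).2) h)
  refine ⟨fun x y => φ x < φ y, ?_, fun x y hxy => ?_⟩
  · exact { trichotomous := fun x y h1 h2 => hφ (le_antisymm (not_lt.1 h2) (not_lt.1 h1))
            irrefl := fun x => lt_irrefl _
            trans := fun x y z => lt_trans }
  · simp [φ, Prod.Lex.toLex_lt_toLex, hxy]

variable {ι κ} in
lemma exists_arcIncidence_eq_zero [Finite N] (hικ : ∀ v w, ι v ≠ κ w) :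
    ∃ r : N → N → Prop, IsStrictTotalOrder N r ∧
      ∀ v w, arcIncidence r ⟨(ι v, κ w), hικ v w⟩ = 0 := by
  classical
  obtain ⟨r, hr, h⟩ := exists_isStrictTotalOrder_of_level
    (fun x : N => if x ∈ Set.range κ then 0 else 1)
  refine ⟨r, hr, fun v w => ?_⟩
  have h1 : ι v ∉ Set.range κ := fun ⟨u, hu⟩ => hικ v u hu.symm
  have := h (ι v) (κ w)
  simp_all [arcIncidence]

variable [Fintype V] (G : SimpleGraph V) [DecidableRel G.Adj] (a : V → ℕ)

/-- The linear form `∑_v y(v) x_{vv'} + ∑_{vw ∈ E} z(vw) (x_{vw'} + x_{wv'})`. -/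
noncomputable def arcForm (y : V → ℝ) (z : Sym2 V → ℝ) : (Arc N → ℝ) →ₗ[ℝ] ℝ :=
  ∑ v, y v • LinearMap.proj ⟨(ι v, κ v), hικ v v⟩ + ∑ e ∈ G.edgeFinset, z e • crossForm ι κ hικ e

lemma arcForm_apply (y : V → ℝ) (z : Sym2 V → ℝ) (x : Arc N → ℝ) :
    arcForm ι κ hικ G y z x = ∑ v, y v * x ⟨(ι v, κ v), hικ v v⟩ +
      ∑ e ∈ G.edgeFinset, z e * crossForm ι κ hικ e x := by
  simp [arcForm, LinearMap.sum_apply]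

variable [DecidableEq V]

lemma graphicalForm_eq_arcForm :
    graphicalForm G a ι κ hικ = arcForm ι κ hικ G (fun v => a v) (fun _ => -1) := by
  funext x
  rw [arcForm_apply, graphicalForm, sub_eq_add_neg, ← sum_neg_distrib]
  congr 1
  refine sum_congr rfl fun e _ => ?_
  induction e with | _ v w
  simp [crossForm_mk]

variable {G a ι κ hικ} {r : N → N → Prop}

open Classical in
lemma arcForm_arcIncidence (y : V → ℝ) (z : Sym2 V → ℝ) :
    arcForm ι κ hικ G y z (arcIncidence r) = ∑ v with r (ι v) (κ v), y v +
      ∑ e ∈ G.edgeFinset, z e * crossForm ι κ hικ e (arcIncidence r) := by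
  rw [arcForm_apply, sum_filter]
  simp [arcIncidence]

open Classical in
-- If `v < v'` and `w < w'` but not `v < w'`, then `w < w' < v < v'`, so `w < v'`.
lemma boole_le_crossForm (hr : IsStrictTotalOrder N r) (e : Sym2 V) :
    (if ∀ v ∈ e, r (ι v) (κ v) then 1 else 0 : ℝ) ≤ crossForm ι κ hικ e (arcIncidence r) := by
  induction e with | _ v w
  rw [crossForm_mk]
  simp only [arcIncidence]
  by_cases h : ∀ u ∈ s(v, w), r (ι u) (κ u)
  · have hv := h v (Sym2.mem_mk_left v w)
    have hw := h w (Sym2.mem_mk_right v w)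
    rw [if_pos h]
    by_cases hvw : r (ι v) (κ w)
    · rw [if_pos hvw]; split_ifs <;> norm_num
    · have h1 : r (κ w) (ι v) := by
        by_contra h2
        exact hικ v w (hr.trichotomous _ _ hvw h2)
      rw [if_pos (hr.trans _ _ _ (hr.trans _ _ _ hw h1) hv)]
      split_ifs <;> norm_num
  · rw [if_neg h]
    split_ifs <;> norm_num

open Classical in
lemma natCast_numEdgesIn (S : Finset V) :
    (numEdgesIn G S : ℝ) = ∑ e ∈ G.edgeFinset, if ∀ v ∈ e, v ∈ S then (1 : ℝ) else 0 := by
  rw [numEdgesIn, sum_boole]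

open Classical in
/-- A linear ordering whose incidence vector maximizes the graphical form gives a set of vertices
of maximum worth, on which `arcForm` can be evaluated. -/
lemma arcForm_arcIncidence_le (hr : IsStrictTotalOrder N r) :
    arcForm ι κ hικ G (fun v => a v) (fun _ => -1) (arcIncidence r) ≤ maxWorth G a ∧
    (arcForm ι κ hικ G (fun v => a v) (fun _ => -1) (arcIncidence r) = maxWorth G a →
      ∃ S, worth G a S = maxWorth G a ∧ ∀ y z, arcForm ι κ hικ G y z (arcIncidence r) =
        ∑ v ∈ S, y v + ∑ e ∈ G.edgeFinset with ∀ v ∈ e, v ∈ S, z e) := by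
  set S : Finset V := {v | r (ι v) (κ v)} with hS
  have hle : ∀ e ∈ G.edgeFinset, (if ∀ v ∈ e, v ∈ S then 1 else 0 : ℝ) ≤
      crossForm ι κ hικ e (arcIncidence r) := fun e _ => by
    simpa [hS] using boole_le_crossForm (hικ := hικ) hr e
  have hw : (worth G a S : ℝ) ≤ maxWorth G a := by exact_mod_cast le_sup' _ (mem_univ S)
  have hw' : (worth G a S : ℝ) = ∑ v ∈ S, (a v : ℝ) -
      ∑ e ∈ G.edgeFinset, (if ∀ v ∈ e, v ∈ S then 1 else 0 : ℝ) := by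
    rw [← natCast_numEdgesIn]
    simp [worth]
  have hform : arcForm ι κ hικ G (fun v => (a v : ℝ)) (fun _ => -1) (arcIncidence r) =
      ∑ v ∈ S, (a v : ℝ) - ∑ e ∈ G.edgeFinset, crossForm ι κ hικ e (arcIncidence r) := by
    rw [arcForm_arcIncidence]
    simp [sub_eq_add_neg, hS]
  have hsum := sum_le_sum hle
  refine ⟨by linarith, fun heq => ⟨S, ?_, fun y z => ?_⟩⟩
  · have : (worth G a S : ℝ) = maxWorth G a := by linarith
    exact_mod_cast this
  -- Equality of the sums forces equality edge by edge.
  · have hall := (sum_eq_sum_iff_of_le hle).1 (by linarith)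
    rw [arcForm_arcIncidence, sum_filter (s := G.edgeFinset)]
    congr 1
    refine sum_congr rfl fun e he => ?_
    rw [← hall e he]
    split_ifs <;> simp

/-- Order the nodes as `V' \ {w'}`, then `v`, `w'`, and the rest. Such orderings read off single
coefficients of `arcForm`: of a vertex if `v = w`, of an edge if `vw` is one. -/
lemma exists_arcIncidence_eq_single [Finite N] (hι : Function.Injective ι)
    (hκ : Function.Injective κ) (hικ : ∀ v w, ι v ≠ κ w) (v w : V) :
    ∃ r : N → N → Prop, IsStrictTotalOrder N r ∧
      ∀ s t, arcIncidence r ⟨(ι s, κ t), hικ s t⟩ = if s = v ∧ t = w then 1 else 0 := by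
  classical
  let k : N → ℕ := fun x =>
    if x = κ w then 2 else if x ∈ Set.range κ then 0 else if x = ι v then 1 else 3
  have hkκ : ∀ t, k (κ t) = if t = w then 2 else 0 := fun t => by simp [k, hκ.eq_iff]
  have hkι : ∀ s, k (ι s) = if s = v then 1 else 3 := fun s => by
    have h1 : ι s ∉ Set.range κ := fun ⟨u, hu⟩ => hικ s u hu.symm
    simp only [k, hικ s w, h1, hι.eq_iff, if_false]
  obtain ⟨r, hr, h⟩ := exists_isStrictTotalOrder_of_level k
  refine ⟨r, hr, fun s t => ?_⟩
  have h1 := h (ι s) (κ t)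
  rw [hkι, hkκ] at h1
  by_cases hs : s = v <;> by_cases ht : t = w <;> simp_all [arcIncidence]

end ArcForm

/-- On a facet-defining graph, the affine equations in vertex and edge variables that hold for
all sets of maximum worth are the multiples of `a(S) - ‖S‖ = β(G,a)`. -/
theorem IsFacetDefiningGraph.exists_eq_mul {V : Type*} [Fintype V] [DecidableEq V]
    {G : SimpleGraph V} [DecidableRel G.Adj] {a : V → ℕ} {N : Type*} [Finite N] {ι κ : V ↪ N}
    {hικ : ∀ v w, ι v ≠ κ w} (hG : IsFacetDefiningGraph G a ι κ hικ)
    {y : V → ℝ} {z : Sym2 V → ℝ} {c : ℝ}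
    (h : ∀ S, worth G a S = maxWorth G a →
      ∑ v ∈ S, y v + ∑ e ∈ G.edgeFinset with ∀ v ∈ e, v ∈ S, z e = c) :
    ∃ μ : ℝ, (∀ v, y v = μ * a v) ∧ ∀ e ∈ G.edgeFinset, z e = -μ := by
  classical
  have := Fintype.ofFinite N
  have hfacet := hG.definesFacet
  rw [graphicalForm_eq_arcForm] at hfacet
  set f := arcForm ι κ hικ G (fun v => (a v : ℝ)) (fun _ => -1) with hf
  set g := arcForm ι κ hικ G y z with hg
  have hface : ∀ x ∈ linearOrderingPolytope N, f x = maxWorth G a → g x = c := by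
    -- A proper convex combination attains `f = β` only if both points do, so the equation `g = c`
    -- passes from the orderings on the face to the whole face.
    have hconv : Convex ℝ {x | f x < maxWorth G a ∨ (f x = maxWorth G a ∧ g x = c)} := by
      intro p hp q hq s t hs ht hst
      simp only [Set.mem_ofPred_eq, map_add, map_smul, smul_eq_mul] at hp hq ⊢
      rcases hs.eq_or_lt with rfl | hs
      · obtain rfl : t = 1 := by linarith
        simpa using hq
      rcases ht.eq_or_lt with rfl | ht
      · obtain rfl : s = 1 := by linarith
        simpa using hp
      obtain rfl : t = 1 - s := by linarith
      rcases hp with hp | ⟨hp, hp'⟩ <;> rcases hq with hq | ⟨hq, hq'⟩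
      · left; nlinarith
      · left; rw [hq]; nlinarith
      · left; rw [hp]; nlinarith
      · right; rw [hp, hq, hp', hq']; constructor <;> ring
    intro x hx hfx
    have hsub := convexHull_min (s := {x | ∃ r : N → N → Prop, IsStrictTotalOrder N r ∧
      x = arcIncidence r}) ?_ hconv
    · rcases hsub hx with h1 | h1
      · exact absurd hfx h1.ne
      · exact h1.2
    · rintro _ ⟨r, hr, rfl⟩
      obtain ⟨h1, h2⟩ := arcForm_arcIncidence_le (G := G) (a := a) (hικ := hικ) hr
      rcases h1.lt_or_eq with h1 | h1
      · exact Or.inl h1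
      · obtain ⟨S, hS, hS'⟩ := h2 h1
        exact Or.inr ⟨h1, by rw [hg, hS', h S hS]⟩
  have hmem : ∀ r : N → N → Prop, IsStrictTotalOrder N r →
      arcIncidence r ∈ linearOrderingPolytope N := fun r hr =>
    subset_convexHull ℝ _ ⟨r, hr, rfl⟩
  obtain ⟨r₀, hr₀, h₀⟩ := exists_arcIncidence_eq_zero hικ
  have hcross₀ : ∀ e, crossForm ι κ hικ e (arcIncidence r₀) = 0 := fun e => by
    induction e with | _ v w
    simp [crossForm_mk, h₀]
  have hform₀ : ∀ y z, arcForm ι κ hικ G y z (arcIncidence r₀) = 0 := fun y z => by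
    simp [arcForm_apply, h₀, hcross₀]
  choose r hr hrs using exists_arcIncidence_eq_single ι.injective κ.injective hικ
  have hform_vertex : ∀ y z v, arcForm ι κ hικ G y z (arcIncidence (r v v)) = y v := by
    intro y z v
    have hcross : ∀ e ∈ G.edgeFinset, crossForm ι κ hικ e (arcIncidence (r v v)) = 0 := by
      intro e he
      induction e with | _ s t
      have hst : s ≠ t := G.ne_of_adj (by simpa using he)
      rw [crossForm_mk, hrs, hrs, if_neg (fun h => hst (h.1.trans h.2.symm)),
        if_neg (fun h => hst (h.2.trans h.1.symm)), add_zero]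
    rw [arcForm_apply, sum_eq_zero (s := G.edgeFinset) fun e he => by rw [hcross e he, mul_zero]]
    simp [hrs]
  have hform_edge : ∀ y z v w, G.Adj v w →
      arcForm ι κ hικ G y z (arcIncidence (r v w)) = z s(v, w) := by
    intro y z v w hvw
    have hne := G.ne_of_adj hvw
    have hcross : ∀ e ∈ G.edgeFinset, crossForm ι κ hικ e (arcIncidence (r v w)) =
        if e = s(v, w) then 1 else 0 := by
      intro e he
      induction e with | _ s t
      have hst : s ≠ t := G.ne_of_adj (by simpa using he)
      rw [crossForm_mk, hrs, hrs]
      simp only [Sym2.eq_iff]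
      by_cases h1 : s = v ∧ t = w
      · have h2 : ¬ (t = v ∧ s = w) := fun h2 => hst (h1.1.trans h2.1.symm)
        simp [h1, hne, hne.symm]
      · by_cases h2 : t = v ∧ s = w
        · simp [h2, hne.symm]
        · rw [if_neg h1, if_neg h2, if_neg (by tauto), add_zero]
    have hzero : ∀ u, ¬ (u = v ∧ u = w) := fun u h => hne (h.1.symm.trans h.2)
    rw [arcForm_apply, sum_congr (s₁ := G.edgeFinset) rfl fun e he => by rw [hcross e he]]
    simp [hrs, hzero, hvw]
  have hcard := hG.three_le_card
  obtain ⟨v₀⟩ : Nonempty V := Fintype.card_pos_iff.1 (by omega)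
  have hne : f (arcIncidence (r v₀ v₀)) ≠ f (arcIncidence r₀) := by
    rw [hf, hform_vertex, hform₀]
    exact_mod_cast (hG.weight_pos v₀).ne'
  obtain ⟨μ, hμ⟩ := hfacet.exists_eq_mul hface (hmem _ (hr v₀ v₀)) (hmem _ hr₀) hne
  refine ⟨μ, fun v => ?_, fun e he => ?_⟩
  · have := hμ _ (hmem _ (hr v v)) _ (hmem _ hr₀)
    rwa [hf, hg, hform_vertex, hform_vertex, hform₀, hform₀, sub_zero, sub_zero] at this
  · induction e with | _ v w
    have hvw : G.Adj v w := by simpa using he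
    have := hμ _ (hmem _ (hr v w)) _ (hmem _ hr₀)
    rw [hf, hg, hform_edge _ _ _ _ hvw, hform_edge _ _ _ _ hvw, hform₀, hform₀, sub_zero,
      sub_zero] at this
    linarith

lemma exists_ne_ne_of_three_le_card {V : Type*} [Fintype V] [DecidableEq V]
    (h : 3 ≤ Fintype.card V) (v w : V) : ∃ u, u ≠ v ∧ u ≠ w := by
  obtain ⟨u, -, hu⟩ := exists_mem_notMem_of_card_lt_card (s := {v, w}) (t := univ)
    (lt_of_le_of_lt card_le_two (by rw [card_univ]; exact h))
  exact ⟨u, by simpa [not_or] using hu⟩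

/-! ### Tight sets and the bounds on weights and degrees -/

namespace IsFacetDefiningGraph

variable {V : Type*} [Fintype V] [DecidableEq V] {G : SimpleGraph V} [DecidableRel G.Adj]
  {a : V → ℕ} {N : Type*} [Finite N] {ι κ : V ↪ N} {hικ : ∀ v w, ι v ≠ κ w}

/-- Since `a(u) > 0`, the multiplier is zero. Tight sets of a required kind exist because otherwise
an indicator equation would violate this. -/
lemma eq_zero_of_vertex_eq_zero (hG : IsFacetDefiningGraph G a ι κ hικ)
    {y : V → ℝ} {z : Sym2 V → ℝ} {c : ℝ}
    (h : ∀ S, worth G a S = maxWorth G a →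
      ∑ v ∈ S, y v + ∑ e ∈ G.edgeFinset with ∀ v ∈ e, v ∈ S, z e = c)
    {u : V} (hu : y u = 0) : (∀ v, y v = 0) ∧ ∀ e ∈ G.edgeFinset, z e = 0 := by
  obtain ⟨μ, h1, h2⟩ := hG.exists_eq_mul h
  have hau : (a u : ℝ) ≠ 0 := by exact_mod_cast (hG.weight_pos u).ne'
  have hμ : μ = 0 := by simpa [hau, hu] using (h1 u).symm
  exact ⟨fun v => by rw [h1, hμ, zero_mul], fun e he => by rw [h2 e he, hμ, neg_zero]⟩

lemma exists_worth_eq_and_mem (hG : IsFacetDefiningGraph G a ι κ hικ) (v : V) :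
    ∃ S, worth G a S = maxWorth G a ∧ v ∈ S := by
  by_contra! h
  obtain ⟨u, hu, -⟩ := exists_ne_ne_of_three_le_card hG.three_le_card v v
  have := (hG.eq_zero_of_vertex_eq_zero (y := fun x => if x = v then 1 else 0) (z := fun _ => 0)
    (c := 0) (fun S hS => by simp [h S hS]) (u := u) (by simp [hu])).1 v
  simp at this

lemma exists_worth_eq_and_notMem (hG : IsFacetDefiningGraph G a ι κ hικ) (v : V) :
    ∃ S, worth G a S = maxWorth G a ∧ v ∉ S := by
  by_contra! h
  obtain ⟨u, hu, -⟩ := exists_ne_ne_of_three_le_card hG.three_le_card v v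
  have := (hG.eq_zero_of_vertex_eq_zero (y := fun x => if x = v then 1 else 0) (z := fun _ => 0)
    (c := 1) (fun S hS => by simp [h S hS]) (u := u) (by simp [hu])).1 v
  simp at this

lemma exists_worth_eq_and_adj_mem (hG : IsFacetDefiningGraph G a ι κ hικ) {v w : V}
    (hvw : G.Adj v w) : ∃ S, worth G a S = maxWorth G a ∧ v ∈ S ∧ w ∈ S := by
  by_contra! h
  have := (hG.eq_zero_of_vertex_eq_zero (y := fun _ => 0)
    (z := fun e => if e = s(v, w) then 1 else 0)
    (c := 0) (fun S hS => by simpa using fun _ => h S hS) (u := v) rfl).2 s(v, w) (by simpa using hvw)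
  simp at this

lemma exists_worth_eq_and_adj_notMem (hG : IsFacetDefiningGraph G a ι κ hικ) {v w : V}
    (hvw : G.Adj v w) : ∃ S, worth G a S = maxWorth G a ∧ v ∉ S ∧ w ∉ S := by
  by_contra! h
  obtain ⟨u, huv, huw⟩ := exists_ne_ne_of_three_le_card hG.three_le_card v w
  -- The form indicates whether `S` meets `{v, w}`; the third vertex `u` provides the zero
  -- coefficient.
  have := (hG.eq_zero_of_vertex_eq_zero
    (y := fun x => (if x = v then 1 else 0) + if x = w then 1 else 0)
    (z := fun e => if e = s(v, w) then -1 else 0)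
    (c := 1) (fun S hS => by
      have := h S hS
      by_cases hv : v ∈ S <;> by_cases hw : w ∈ S <;>
        simp_all [sum_add_distrib]) (u := u) (by simp [huv, huw])).2 s(v, w) (by simpa using hvw)
  simp at this

lemma pairWorth_self_le {T : Finset V} (hT : worth G a T = maxWorth G a) (S : Finset V) :
    pairWorth G a S S ≤ pairWorth G a T T := by
  rw [pairWorth_self, pairWorth_self, hT]
  linarith [worth_le_maxWorth G a S]

/-- Every vertex is missed by a tight set, so uncrossing with all tight sets empties `I`. -/
lemma pairWorth_le_sum (hG : IsFacetDefiningGraph G a ι κ hικ) {I U : Finset V} (hIU : I ⊆ U) :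
    pairWorth G a I U ≤ ∑ v, (a v : ℤ) := by
  have h := pairWorth_le_filter_biUnion (F := {T | worth G a T = maxWorth G a}) (I' := ∅)
    (fun T hT => pairWorth_self_le (mem_filter.1 hT).2) hIU fun x => by
      obtain ⟨T, hT, hxT⟩ := hG.exists_worth_eq_and_notMem x
      simp only [notMem_empty, false_iff, not_and, not_forall]
      exact fun _ => ⟨T, by simpa using hT, hxT⟩
  refine h.trans ?_
  simp only [pairWorth, adjPairs, sum_empty, zero_add, sub_zero]
  exact sum_le_sum_of_subset_of_nonneg (subset_univ _) fun _ _ _ => by positivity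

/-- Uncross with the tight sets avoiding `v`. Each edge at `v` is disjoint from one of them, so `I'`
has no neighbour of `v`, and adding `v` to `U'` gains all of `a(v)`. -/
lemma pairWorth_add_weight_le (hG : IsFacetDefiningGraph G a ι κ hικ) {v : V} {I U : Finset V}
    (hIU : I ⊆ U) (hv : v ∉ U) : pairWorth G a I U + a v ≤ ∑ v, (a v : ℤ) := by
  set F : Finset (Finset V) := {T | worth G a T = maxWorth G a ∧ v ∉ T} with hF
  set I' : Finset V := {x ∈ I | ∀ T ∈ F, x ∈ T} with hI'
  have h := pairWorth_le_filter_biUnion (F := F) (I' := I')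
    (fun T hT => pairWorth_self_le (mem_filter.1 hT).2.1) hIU
    (fun x => by rw [hI', mem_filter])
  set U' : Finset V := U ∪ F.biUnion id with hU'
  have hvU : v ∉ U' := by
    simp only [hU', mem_union, mem_biUnion, id, not_or, not_exists, not_and]
    exact ⟨hv, fun T hT => (mem_filter.1 hT).2.2⟩
  have hIU' : I' ⊆ U' ∪ {v} :=
    ((filter_subset _ _).trans hIU).trans (subset_union_left.trans subset_union_left)
  have hadj : adjPairs G I' {v} = 0 := by
    refine sum_eq_zero fun x hx => ?_
    rw [sum_singleton, if_neg]
    intro hxv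
    obtain ⟨T, hT, hxT, hvT⟩ := hG.exists_worth_eq_and_adj_notMem hxv
    exact hxT ((mem_filter.1 hx).2 T (by simp [hF, hT, hvT]))
  have hd : Disjoint U' {v} := disjoint_singleton_right.2 hvU
  have h2 := hG.pairWorth_le_sum hIU'
  rw [pairWorth, sum_union hd, adjPairs_union_right G hd, hadj, sum_singleton] at h2
  rw [pairWorth, pairWorth] at h
  rw [pairWorth]
  linarith

/-- Uncross with the tight sets containing `v`. Each edge at `v` lies in one of them, so `U'` has
all neighbours of `v`, and deleting `v` from `I'` changes the value by `deg(v) - a(v)`. -/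
lemma pairWorth_add_degree_le (hG : IsFacetDefiningGraph G a ι κ hικ) {v : V} {I U : Finset V}
    (hIU : I ⊆ U) (hv : v ∈ I) : pairWorth G a I U + G.degree v ≤ ∑ v, (a v : ℤ) + a v := by
  set F : Finset (Finset V) := {T | worth G a T = maxWorth G a ∧ v ∈ T} with hF
  set I' : Finset V := {x ∈ I | ∀ T ∈ F, x ∈ T} with hI'
  have h := pairWorth_le_filter_biUnion (F := F) (I' := I')
    (fun T hT => pairWorth_self_le (mem_filter.1 hT).2.1) hIU
    (fun x => by rw [hI', mem_filter])
  set U' : Finset V := U ∪ F.biUnion id with hU'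
  have hIU' : I' ⊆ U' := ((filter_subset _ _).trans hIU).trans subset_union_left
  have hvI : v ∈ I' := mem_filter.2 ⟨hv, fun T hT => (mem_filter.1 hT).2.2⟩
  have hadj : adjPairs G {v} U' = G.degree v := by
    rw [← adjPairs_singleton_univ]
    simp only [adjPairs, sum_singleton]
    refine sum_subset (subset_univ _) fun x _ hx => if_neg fun hvx => hx ?_
    obtain ⟨T, hT, hvT, hxT⟩ := hG.exists_worth_eq_and_adj_mem hvx
    exact mem_union_right _ (mem_biUnion.2 ⟨T, by simp [hF, hT, hvT], hxT⟩)
  have hd : Disjoint (I' \ {v}) {v} := sdiff_disjoint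
  have hI'' : I' = I' \ {v} ∪ {v} := (sdiff_union_of_subset (singleton_subset_iff.2 hvI)).symm
  have h2 := hG.pairWorth_le_sum (sdiff_subset.trans hIU' : I' \ {v} ⊆ U')
  rw [hI'', pairWorth, pairWorth, sum_union hd, adjPairs_union_left G hd, hadj,
    sum_singleton] at h
  rw [pairWorth] at h2 ⊢
  linarith

lemma two_mul_maxWorth_le_pairWorth {S T : Finset V} (hS : worth G a S = maxWorth G a)
    (hT : worth G a T = maxWorth G a) :
    2 * maxWorth G a ≤ pairWorth G a (S ∩ T) (S ∪ T) := by
  have := pairWorth_inter_union G a S T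
  rw [pairWorth_self, pairWorth_self, hS, hT] at this
  linarith [adjPairs_nonneg G (S \ T) (S \ T), adjPairs_nonneg G (T \ S) (T \ S)]

lemma two_mul_maxWorth_lt_pairWorth {S T : Finset V} (hS : worth G a S = maxWorth G a)
    (hT : worth G a T = maxWorth G a) {v w : V} (hvw : G.Adj v w) (hv : v ∈ S \ T)
    (hw : w ∈ S \ T) : 2 * maxWorth G a < pairWorth G a (S ∩ T) (S ∪ T) := by
  have := pairWorth_inter_union G a S T
  rw [pairWorth_self, pairWorth_self, hS, hT] at this
  linarith [adjPairs_pos hv hw hvw, adjPairs_nonneg G (T \ S) (T \ S)]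

lemma weight_le_subdefect (hG : IsFacetDefiningGraph G a ι κ hικ) (v : V) :
    (a v : ℤ) ≤ subdefect G a := by
  obtain ⟨S, hS, hv⟩ := hG.exists_worth_eq_and_notMem v
  have h1 := hG.pairWorth_add_weight_le (inter_subset_union : S ∩ S ⊆ S ∪ S) (by simpa using hv)
  have h2 := two_mul_maxWorth_le_pairWorth hS hS
  rw [subdefect]
  push_cast
  linarith

lemma degree_le (hG : IsFacetDefiningGraph G a ι κ hικ) (v : V) :
    (G.degree v : ℤ) ≤ a v + subdefect G a := by
  obtain ⟨S, hS, hv⟩ := hG.exists_worth_eq_and_mem v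
  have h1 := hG.pairWorth_add_degree_le (inter_subset_union : S ∩ S ⊆ S ∪ S) (by simpa using hv)
  have h2 := two_mul_maxWorth_le_pairWorth hS hS
  rw [subdefect]
  push_cast
  linarith

/-- Otherwise some tight set avoids `v` and its neighbour, if any; adding `v` would raise the worth
by `a(v) > 0`. -/
lemma two_le_degree (hG : IsFacetDefiningGraph G a ι κ hικ) (v : V) : 2 ≤ G.degree v := by
  by_contra! hlt
  have key : ∃ S, worth G a S = maxWorth G a ∧ v ∉ S ∧ ∀ u ∈ S, ¬ G.Adj v u := by
    by_cases hw : ∃ w, G.Adj v w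
    · obtain ⟨w, hw⟩ := hw
      obtain ⟨S, hS, hv, hwS⟩ := hG.exists_worth_eq_and_adj_notMem hw
      refine ⟨S, hS, hv, fun u hu hvu => hwS ?_⟩
      rw [← G.card_neighborFinset_eq_degree] at hlt
      rwa [card_le_one.1 (Nat.le_of_lt_succ hlt) w ((G.mem_neighborFinset v w).2 hw) u
        ((G.mem_neighborFinset v u).2 hvu)]
    · obtain ⟨S, hS, hv⟩ := hG.exists_worth_eq_and_notMem v
      exact ⟨S, hS, hv, fun u _ hvu => hw ⟨u, hvu⟩⟩
  obtain ⟨S, hS, hv, hadj⟩ := key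
  have h := pairWorth_self_le hS (S ∪ {v})
  have hd : Disjoint S {v} := disjoint_singleton_right.2 hv
  have h0 : adjPairs G {v} S = 0 := by
    rw [adjPairs, sum_singleton]
    exact sum_eq_zero fun u hu => if_neg (hadj u hu)
  have h1 : adjPairs G {v} {v} = 0 := by simp [adjPairs]
  simp only [pairWorth, sum_union hd, adjPairs_union_left G hd, adjPairs_union_right G hd,
    adjPairs_comm G S {v}, h0, h1, sum_singleton] at h
  have := hG.weight_pos v
  omega

/-- The degrees sum to at least `4 + 2(|V| - 1) = 2|V| + 2`. -/
lemma card_lt_card_edgeFinset (hG : IsFacetDefiningGraph G a ι κ hικ) {v : V}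
    (hv : 4 ≤ G.degree v) : Fintype.card V < #G.edgeFinset := by
  have h1 := G.sum_degrees_eq_twice_card_edges
  rw [← add_sum_erase _ _ (mem_univ v)] at h1
  have h2 := card_nsmul_le_sum (univ.erase v) (fun u => G.degree u) 2 fun u _ => hG.two_le_degree u
  rw [card_erase_of_mem (mem_univ v), card_univ, smul_eq_mul] at h2
  have := hG.three_le_card
  omega

end IsFacetDefiningGraph

/-! ### Edge indicators as affine functions, and the strict degree bound -/

section Incidence

variable {V : Type*} [DecidableEq V] (G : SimpleGraph V) [DecidableRel G.Adj] [Fintype V]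

/-- Suppose that no edge is contained in one member of `F` and disjoint from another. Then on `F`
the indicator of the edges contained in a set is an affine function of the indicator of its
vertices. -/
lemma exists_sum_edges_eq {F : Set (Finset V)}
    (hF : ∀ S ∈ F, ∀ T ∈ F, ∀ v w, G.Adj v w → v ∈ S \ T → w ∉ S \ T) :
    ∃ σ : Sym2 V → ℝ, ∀ T ∈ F, ∀ z : Sym2 V → ℝ,
      ∑ e ∈ G.edgeFinset with ∀ v ∈ e, v ∈ T, z e =
        ∑ u ∈ T, ∑ e ∈ G.edgeFinset, (if u ∈ e then σ e * z e else 0)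
          - ∑ e ∈ G.edgeFinset, σ e * z e := by
  classical
  -- If some member of `F` contains the edge `xy`, every member meets it, and its indicator is `1_x
  -- + 1_y - 1`; otherwise it is `0` on `F`.
  refine ⟨fun e => if ∃ S ∈ F, ∀ v ∈ e, v ∈ S then 1 else 0, fun T hT z => ?_⟩
  rw [sum_comm, ← sum_sub_distrib, sum_filter]
  refine sum_congr rfl fun e he => ?_
  induction e with | _ x y
  have hxy : G.Adj x y := by simpa using he
  have hne := G.ne_of_adj hxy
  have hsum : ∀ c : ℝ, ∑ u ∈ T, (if u ∈ s(x, y) then c else 0) =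
      (if x ∈ T then c else 0) + if y ∈ T then c else 0 := by
    intro c
    rw [← sum_ite_eq' T x fun _ => c, ← sum_ite_eq' T y fun _ => c, ← sum_add_distrib]
    refine sum_congr rfl fun u _ => ?_
    by_cases hx : u = x
    · simp [hx, hne]
    · by_cases hy : u = y <;> simp [hx, hy, hne.symm]
  rw [hsum]
  simp only [Sym2.ball]
  by_cases hS : ∃ S ∈ F, x ∈ S ∧ y ∈ S
  · have hT' : x ∉ T → y ∈ T := by
      obtain ⟨S, hS', hxS, hyS⟩ := hS
      simpa [hxS, hyS] using hF S hS' T hT x y hxy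
    simp only [hS, if_true, one_mul]
    by_cases hx : x ∈ T
    · simp [hx]
    · simp [hx, hT' hx]
  · have hT' : ¬ (x ∈ T ∧ y ∈ T) := fun h => hS ⟨T, hT, h⟩
    simp [hS, hT']

end Incidence

namespace IsFacetDefiningGraph

variable {V : Type*} [Fintype V] [DecidableEq V] {G : SimpleGraph V} [DecidableRel G.Adj]
  {a : V → ℕ} {N : Type*} [Finite N] {ι κ : V ↪ N} {hικ : ∀ v w, ι v ≠ κ w}

/-- If, among the sets of maximum worth that contain `v` and among those that do not, no edge is
contained in one set and disjoint from another, then there are at most as many edges as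
vertices. -/
lemma card_edgeFinset_le (hG : IsFacetDefiningGraph G a ι κ hικ) {v : V}
    (h : ∀ S T, worth G a S = maxWorth G a → worth G a T = maxWorth G a → (v ∈ S ↔ v ∈ T) →
      ∀ x y, G.Adj x y → x ∈ S \ T → y ∉ S \ T) : #G.edgeFinset ≤ Fintype.card V := by
  by_contra! hlt
  obtain ⟨σ, hσ⟩ := exists_sum_edges_eq G (F := {T | worth G a T = maxWorth G a ∧ v ∉ T})
    fun S hS T hT => h S T hS.1 hT.1 (iff_of_false hS.2 hT.2)
  obtain ⟨τ, hτ⟩ := exists_sum_edges_eq G (F := {T | worth G a T = maxWorth G a ∧ v ∈ T})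
    fun S hS T hT => h S T hS.1 hT.1 (iff_of_true hS.2 hT.2)
  obtain ⟨e₀, he₀⟩ : G.edgeFinset.Nonempty := card_pos.1 (by omega)
  -- The rows `u ≠ v` make the vertex coefficients of the two classes agree. At `v` agreement is not
  -- needed, since `y v` can absorb the difference; row `v` instead imposes `z e₀ = 0`, which will
  -- force `μ = 0`.
  let M : Matrix V G.edgeFinset ℝ := fun u e =>
    if u = v then if e.1 = e₀ then 1 else 0 else if u ∈ e.1 then τ e.1 - σ e.1 else 0
  obtain ⟨z', hz', hz'0⟩ := (Submodule.ne_bot_iff _).1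
    (LinearMap.ker_ne_bot_of_finrank_lt (f := M.mulVecLin) (by
      rwa [Module.finrank_fintype_fun_eq_card, Module.finrank_fintype_fun_eq_card,
        Fintype.card_coe]))
  let z : Sym2 V → ℝ := fun e => if he : e ∈ G.edgeFinset then z' ⟨e, he⟩ else 0
  have hM : ∀ u, ∑ e ∈ G.edgeFinset, (if u = v then if e = e₀ then 1 else 0 else
      if u ∈ e then τ e - σ e else 0) * z e = 0 := by
    intro u
    have : ∑ e, M u e * z' e = 0 := congrFun (LinearMap.mem_ker.1 hz') u
    rw [← sum_attach]
    refine Eq.trans (sum_congr rfl fun e _ => ?_) this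
    simp only [z, dif_pos e.2, M]
  have hz₀ : z e₀ = 0 := by simpa [he₀] using hM v
  have hinc : ∀ u, u ≠ v → ∑ e ∈ G.edgeFinset, (if u ∈ e then σ e * z e else 0) =
      ∑ e ∈ G.edgeFinset, (if u ∈ e then τ e * z e else 0) := by
    intro u hu
    rw [← sub_eq_zero, ← sum_sub_distrib, ← neg_eq_zero, ← sum_neg_distrib, ← hM u]
    refine sum_congr rfl fun e _ => ?_
    rw [if_neg hu]
    split_ifs <;> ring
  set cσ := ∑ e ∈ G.edgeFinset, σ e * z e
  set cτ := ∑ e ∈ G.edgeFinset, τ e * z e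
  let y : V → ℝ := fun u => -(∑ e ∈ G.edgeFinset, if u ∈ e then τ e * z e else 0) +
    if u = v then cτ - cσ else 0
  obtain ⟨μ, -, hμ⟩ := hG.exists_eq_mul (y := y) (z := z) (c := -cσ) fun T hT => by
    simp only [y, sum_add_distrib, sum_neg_distrib, sum_ite_eq']
    by_cases hv : v ∈ T
    · rw [hτ T ⟨hT, hv⟩, if_pos hv]
      ring
    · rw [hσ T ⟨hT, hv⟩, if_neg hv,
        sum_congr rfl fun u hu => hinc u (ne_of_mem_of_not_mem hu hv)]
      ring
  have hμ0 : μ = 0 := by simpa [hz₀] using (hμ e₀ he₀).symm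
  refine hz'0 (funext fun e => ?_)
  have := hμ e.1 e.2
  rwa [hμ0, neg_zero, show z e.1 = z' e from dif_pos e.2] at this

lemma degree_lt (hG : IsFacetDefiningGraph G a ι κ hικ) (h : 1 < subdefect G a) (v : V) :
    (G.degree v : ℤ) < 2 * subdefect G a := by
  by_contra! hdeg
  have h1 := hG.weight_le_subdefect v
  have h2 := hG.degree_le v
  -- Here `λ > 1` enters: it gives `deg(v) ≥ 2λ ≥ 4`.
  have hlt := hG.card_lt_card_edgeFinset (v := v) (by omega)
  have hsub : subdefect G a = ∑ v, (a v : ℤ) - 2 * maxWorth G a := by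
    rw [subdefect]; push_cast; rfl
  refine hlt.not_ge (hG.card_edgeFinset_le (v := v) fun S T hS hT hST x y hxy hx hy => ?_)
  have h3 := two_mul_maxWorth_lt_pairWorth hS hT hxy hx hy
  by_cases hv : v ∈ S
  · have := hG.pairWorth_add_degree_le (inter_subset_union : S ∩ T ⊆ S ∪ T)
      (mem_inter.2 ⟨hv, hST.1 hv⟩)
    omega
  · have := hG.pairWorth_add_weight_le (inter_subset_union : S ∩ T ⊆ S ∪ T)
      (v := v) (by simp [hv, ← hST])
    omega

end IsFacetDefiningGraph

/-- The node set `N` of the linear ordering polytope is any finite set that contains `V` and a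
disjoint copy `V'` of `V`. -/
theorem mainTheorem4 {V : Type*} [Fintype V] [DecidableEq V] (G : SimpleGraph V)
    [DecidableRel G.Adj] (a : V → ℕ) {N : Type*} [Finite N] (ι κ : V ↪ N)
    (hικ : ∀ v w, ι v ≠ κ w) (hG : IsFacetDefiningGraph G a ι κ hικ) :
    (∀ v, (G.degree v : ℤ) ≤ (a v : ℤ) + subdefect G a ∧
      (a v : ℤ) + subdefect G a ≤ 2 * subdefect G a) ∧
    (1 < subdefect G a → ∀ v, (G.degree v : ℤ) ≤ 2 * subdefect G a - 1) := by
  refine ⟨fun v => ⟨hG.degree_le v, ?_⟩, fun h v => ?_⟩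
  · have := hG.weight_le_subdefect v
    omega
  · have := hG.degree_lt h v
    omega
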